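/- The partial-computing red-blue pebble game (PRBP) with $r$ red pebbles is played on a finite DAG. At any time each node carries no pebble, only a blue pebble, a blue and a light red pebble, or only a dark red pebble; light and dark red pebbles are called red, and at any time at most $r$ nodes carry a red pebble. Every edge is marked or unmarked. Initially every source carries a blue pebble, all other nodes carry no pebble, and all edges are unmarked. The allowed operations are: (1) save: replace a dark red pebble on a node by a blue and a light red pebble; (2) load: place a light red pebble on a node that carries a blue pebble; (3) partial compute: for an unmarked edge $(u,v)$ such that all incoming edges of $u$ are marked, $u$ carries a red pebble, and $v$ carries either a red pebble or no pebble, replace all pebbles on $v$ by a dark red pebble and mark $(u,v)$; (4) delete: remove a light red pebble from a node, or a dark red pebble from a node all of whose outgoing edges are marked. A strategy is valid if it ends with all edges marked and a blue pebble on every sink. Its cost is its number of save and load operations, and $\mathrm{OPT}_{PRBP}$ denotes the minimum cost of a valid strategy. For $m=2^k$, the $m$-point butterfly (FFT) DAG is defined recursively: the $1$-point DAG is a single node, and for $m \ge 2$ the $m$-point DAG is obtained from two disjoint copies of the $\frac m2$-point DAG, whose sinks are labelled $u_1,\dots,u_{m/2}$ and $u_{m/2+1},\dots,u_m$ in order,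 by adding new nodes $v_1,\dots,v_m$ and all edges $(u_i,v_j)$ with $i\equiv j \pmod{m/2}$. Theorem. For the $m$-point butterfly (FFT) DAG, $\mathrm{OPT}_{PRBP} = \Omega\!\left(\frac{m\log m}{\log r}\right)$. That is, there is an absolute constant $c>0$ such that for every power of two $m=2^k$ ($k\ge 0$) and every integer $r\ge 2$, a valid PRBP strategy with $r$ red pebbles exists on the $m$-point butterfly DAG, and $$\mathrm{OPT}_{PRBP} \;\ge\; c\cdot\frac{m\log m}{\log r}.$$ -/

import Mathlib

namespace PRBP

/-- The four possible sets of pebbles on a node: no pebble, only a blue pebble, a blue and a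
light red pebble, only a dark red pebble. -/
inductive Pebbles where
  | empty
  | blue
  | blueLight
  | dark

/-- The node holds a (light or dark) red pebble. -/
def Pebbles.IsRed (p : Pebbles) : Prop := p = .blueLight ∨ p = .dark

/-- The node holds a blue pebble. -/
def Pebbles.HasBlue (p : Pebbles) : Prop := p = .blue ∨ p = .blueLight

/-- A configuration of the game: the pebbles on each node, and the set of marked edges. -/
structure Config (V : Type*) where
  pebbles : V → Pebbles
  marked : Set (V × V)

/-- The operations of the game; `compute u v` is the partial compute step along `(u, v)`. -/
inductive Op (V : Type*) where
  | save (v : V)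
  | load (v : V)
  | compute (u v : V)
  | delete (v : V)

/-- Save and load operations cost `1`; partial compute and delete operations are free. -/
def Op.cost {V : Type*} : Op V → ℕ
  | .save _ => 1
  | .load _ => 1
  | .compute _ _ => 0
  | .delete _ => 0

/-- A source: a node without incoming edges. -/
def IsSource {V : Type*} (G : Digraph V) (v : V) : Prop := ∀ u, ¬ G.Adj u v

/-- A sink: a node without outgoing edges. -/
def IsSink {V : Type*} (G : Digraph V) (v : V) : Prop := ∀ w, ¬ G.Adj v w

/-- The transition rules: `Step G s o t` says that operation `o` may be applied in
configuration `s` and turns it into `t`. -/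
inductive Step {V : Type*} [DecidableEq V] (G : Digraph V) :
    Config V → Op V → Config V → Prop
  | save (s : Config V) (v : V) (hv : s.pebbles v = .dark) :
      Step G s (.save v) ⟨Function.update s.pebbles v .blueLight, s.marked⟩
  | load (s : Config V) (v : V) (hv : (s.pebbles v).HasBlue) :
      Step G s (.load v) ⟨Function.update s.pebbles v .blueLight, s.marked⟩
  | compute (s : Config V) (u v : V) (huv : G.Adj u v) (hnew : (u, v) ∉ s.marked)
      (hu : ∀ w, G.Adj w u → (w, u) ∈ s.marked) (hured : (s.pebbles u).IsRed)
      (hv : (s.pebbles v).IsRed ∨ s.pebbles v = .empty) :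
      Step G s (.compute u v) ⟨Function.update s.pebbles v .dark, insert (u, v) s.marked⟩
  | deleteLight (s : Config V) (v : V) (hv : s.pebbles v = .blueLight) :
      Step G s (.delete v) ⟨Function.update s.pebbles v .blue, s.marked⟩
  | deleteDark (s : Config V) (v : V) (hv : s.pebbles v = .dark)
      (hout : ∀ w, G.Adj v w → (v, w) ∈ s.marked) :
      Step G s (.delete v) ⟨Function.update s.pebbles v .empty, s.marked⟩

/-- The configuration has at most `r` red pebbles. -/
def Config.FitsIn {V : Type*} (s : Config V) (r : ℕ) : Prop :=
  {v | (s.pebbles v).IsRed}.encard ≤ r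

/-- `Run G r s ops t`: the sequence of operations `ops` legally leads from `s` to `t`, and
every configuration on the way has at most `r` red pebbles. -/
inductive Run {V : Type*} [DecidableEq V] (G : Digraph V) (r : ℕ) :
    Config V → List (Op V) → Config V → Prop
  | nil (s : Config V) (hs : s.FitsIn r) : Run G r s [] s
  | cons (s t u : Config V) (o : Op V) (ops : List (Op V)) (hs : s.FitsIn r)
      (hstep : Step G s o t) (hrun : Run G r t ops u) : Run G r s (o :: ops) u

open Classical in
/-- The initial configuration: blue pebbles exactly on the sources, all edges unmarked. -/
noncomputable def initial {V : Type*} (G : Digraph V) : Config V where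
  pebbles v := if IsSource G v then .blue else .empty
  marked := ∅

/-- A terminal configuration: every sink has a blue pebble and every edge is marked. -/
def IsTerminal {V : Type*} (G : Digraph V) (s : Config V) : Prop :=
  (∀ v, IsSink G v → (s.pebbles v).HasBlue) ∧ ∀ u v, G.Adj u v → (u, v) ∈ s.marked

/-- `ops` is a valid pebbling strategy of `G` with at most `r` red pebbles. -/
def IsPebbling {V : Type*} [DecidableEq V] (G : Digraph V) (r : ℕ) (ops : List (Op V)) : Prop :=
  ∃ t, Run G r (initial G) ops t ∧ IsTerminal G t

/-- The I/O cost of a strategy: its number of save and load operations. -/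
def cost {V : Type*} (ops : List (Op V)) : ℕ := (ops.map Op.cost).sum

/-- The optimal I/O cost of `G` with `r` red pebbles (`⊤` if there is no valid pebbling). -/
noncomputable def opt {V : Type*} [DecidableEq V] (G : Digraph V) (r : ℕ) : ℕ∞ :=
  ⨅ (ops : List (Op V)) (_ : IsPebbling G r ops), (cost ops : ℕ∞)

/-- The `2 ^ k`-point FFT (butterfly) graph. It has the layers `0, …, k`, with `2 ^ k` nodes
each, where layer `0` holds the sources and layer `k` the sinks. The layers `0, …, l` consist of
`2 ^ (k - l)` copies of the `2 ^ l`-point FFT graph, on the blocks of `2 ^ l` consecutive indices;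
layer `l + 1` joins consecutive pairs of such copies, by edges from `i` to all `j` in the same
block of length `2 ^ (l + 1)` with `i ≡ j` modulo `2 ^ l`. -/
def fft (k : ℕ) : Digraph (Fin (k + 1) × Fin (2 ^ k)) where
  Adj x y := (y.1 : ℕ) = x.1 + 1 ∧ (x.2 : ℕ) ≡ y.2 [MOD 2 ^ (x.1 : ℕ)] ∧
    (x.2 : ℕ) / 2 ^ ((x.1 : ℕ) + 1) = (y.2 : ℕ) / 2 ^ ((x.1 : ℕ) + 1)

/-- The butterfly graph is acyclic. -/
theorem fft_acyclic (k : ℕ) (x : Fin (k + 1) × Fin (2 ^ k)) :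
    ¬ Relation.TransGen (fft k).Adj x x := by
  have key : ∀ a b, Relation.TransGen (fft k).Adj a b → (a.1 : ℕ) < b.1 := by
    intro a b h
    induction h with
    | single h => have := h.1; omega
    | tail _ h ih => have := h.1; omega
  exact fun h => lt_irrefl _ (key x x h)

/-- The recursive description, new layer: the `2 ^ (k + 1)`-point graph has an edge from node `i`
of layer `k` to node `j` of the last layer if and only if `i ≡ j` modulo `2 ^ k`. -/
theorem fft_succ_adj_last (k : ℕ) (i j : Fin (2 ^ (k + 1))) :
    (fft (k + 1)).Adj (⟨k, by omega⟩, i) (Fin.last (k + 1), j) ↔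
      (i : ℕ) ≡ j [MOD 2 ^ k] := by
  simp [fft, Nat.div_eq_of_lt i.isLt, Nat.div_eq_of_lt j.isLt]

/-- The recursive description, lower layers: the layers `0, …, k` of the `2 ^ (k + 1)`-point graph
are two disjoint copies of the `2 ^ k`-point graph, on the indices below `2 ^ k` and on the others:
the node `i` of the copy `a` has index `2 ^ k * a + i`. -/
theorem fft_succ_adj_lower (k : ℕ) (l l' : Fin (k + 1)) (a b : Fin 2) (i j : Fin (2 ^ k))
    (hi : 2 ^ k * (a : ℕ) + i < 2 ^ (k + 1)) (hj : 2 ^ k * (b : ℕ) + j < 2 ^ (k + 1)) :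
    (fft (k + 1)).Adj (l.castSucc, ⟨2 ^ k * a + i, hi⟩) (l'.castSucc, ⟨2 ^ k * b + j, hj⟩) ↔
      a = b ∧ (fft k).Adj (l, i) (l', j) := by
  by_cases hl : (l' : ℕ) = l + 1
  · have hlk : (l : ℕ) + 1 ≤ k := by omega
    have hdiv : ∀ (e a i : ℕ), e ≤ k →
        (2 ^ k * a + i) / 2 ^ e = 2 ^ (k - e) * a + i / 2 ^ e := by
      intro e a i he
      have : 2 ^ k * a + i = i + 2 ^ e * (2 ^ (k - e) * a) := by
        rw [← mul_assoc, ← pow_add, Nat.add_sub_cancel' he, add_comm]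
      rw [this, Nat.add_mul_div_left _ _ (by positivity), add_comm]
    have hmod : ∀ (a i : ℕ), (2 ^ k * a + i) % 2 ^ (l : ℕ) = i % 2 ^ (l : ℕ) := by
      intro a i
      have : 2 ^ k * a + i = i + 2 ^ (l : ℕ) * (2 ^ (k - l) * a) := by
        rw [← mul_assoc, ← pow_add, Nat.add_sub_cancel' (by omega), add_comm]
      rw [this, Nat.add_mul_mod_self_left]
    have hlt : ∀ i : Fin (2 ^ k), (i : ℕ) / 2 ^ ((l : ℕ) + 1) < 2 ^ (k - (l + 1)) := by
      intro i
      rw [Nat.div_lt_iff_lt_mul (by positivity), ← pow_add, Nat.sub_add_cancel hlk]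
      exact i.isLt
    simp only [fft, Fin.val_castSucc, hl, true_and, Nat.ModEq, hmod, hdiv _ _ _ hlk]
    have h1 := hlt i
    have h2 := hlt j
    constructor
    · rintro ⟨hm, hd⟩
      have hab : (a : ℕ) = b := by
        have ha := congrArg (· / 2 ^ (k - ((l : ℕ) + 1))) hd
        simpa [Nat.mul_add_div, Nat.div_eq_of_lt h1, Nat.div_eq_of_lt h2] using ha
      refine ⟨Fin.ext hab, hm, ?_⟩
      rw [hab] at hd
      exact Nat.add_left_cancel hd
    · rintro ⟨rfl, hm, hd⟩
      exact ⟨hm, by rw [hd]⟩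
  · simp [fft, hl]

end PRBP

/-! The lower bound is a Hong–Kung phase argument adapted to partial computation. Cut a strategy
into phases of cost at most `r`, and in each phase look at the set `U` of tails of newly marked
edges. Let `D` hold the nodes that are red at the start of the phase or loaded during it, so that
`D` has at most `2 * r` elements. A node of `U` outside `D` must have been computed from scratch
within the phase: it is not a source, all its incoming edges were marked in the phase, and so its
predecessors lie in `U` (`Run.exists_isDominatedBy`). The rule that a dark pebble is deleted only
once all outgoing edges are marked is what rules out forgetting a partial result and resuming it
later.

In the butterfly, `s` nodes dominate at most `s log₂ (2 s)` nodes (`card_belowBlock_le`), by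
induction over the blocks and superadditivity of `x log x`. Every one of the `k * 2 ^ k` non-sinks
is the tail of some edge, hence is counted in some phase; with about `cost / r` phases of at most `2
r log₂ (4 r)` tails each, the bound follows (`cost_lower_bound`). Finiteness of the optimum comes
from a strategy that processes one edge at a time (`exists_isPebbling`). -/

namespace PRBP

/-! ### Phases of a strategy and dominating sets -/

section Game

variable {V : Type*} {G : Digraph V} {r : ℕ}

@[simp]
theorem cost_nil : cost ([] : List (Op V)) = 0 := rfl

@[simp]
theorem cost_cons (o : Op V) (ops : List (Op V)) : cost (o :: ops) = o.cost + cost ops := rfl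

theorem Op.cost_le_one (o : Op V) : o.cost ≤ 1 := by
  cases o <;> simp [Op.cost]

theorem Run.fitsIn_left [DecidableEq V] {s t : Config V} {ops : List (Op V)} (h : Run G r s ops t) :
    s.FitsIn r := by
  cases h <;> assumption

theorem Run.append [DecidableEq V]
    {s t u : Config V} {ops₁ ops₂ : List (Op V)} (h₁ : Run G r s ops₁ t)
    (h₂ : Run G r t ops₂ u) : Run G r s (ops₁ ++ ops₂) u := by
  induction h₁ with
  | nil s hs => exact h₂
  | cons s t _ o ops hs hstep _ ih => exact .cons _ _ _ _ _ hs hstep (ih h₂)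

/-- A run can be cut so that the first part has cost at most `q` and the rest is cheaper by `q`. -/
theorem Run.split [DecidableEq V]
    {s t : Config V} {ops : List (Op V)} (h : Run G r s ops t) (q : ℕ) :
    ∃ ops₁ ops₂ u, Run G r s ops₁ u ∧ Run G r u ops₂ t ∧ cost ops₁ ≤ q ∧
      cost ops₂ ≤ cost ops - q := by
  induction h generalizing q with
  | nil s hs => exact ⟨[], [], s, .nil s hs, .nil s hs, by simp, by simp⟩
  | cons s t u o ops hs hstep hrun ih =>
    rcases le_or_gt o.cost q with hq | hq
    · obtain ⟨ops₁, ops₂, w, h₁, h₂, hc₁, hc₂⟩ := ih (q - o.cost)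
      refine ⟨o :: ops₁, ops₂, w, .cons _ _ _ _ _ hs hstep h₁, h₂, ?_, ?_⟩ <;>
        rw [cost_cons] <;> omega
    -- Costs are at most one, so `q = 0` here and the cut comes before `o`.
    · have := o.cost_le_one
      refine ⟨[], o :: ops, s, .nil s hs, .cons _ _ _ _ _ hs hstep hrun, by simp, ?_⟩
      omega

/-- A node without pebbles that has been (partially) computed before is no longer needed. -/
def Config.Coherent (G : Digraph V) (s : Config V) : Prop :=
  ∀ u w x, s.pebbles u = .empty → (w, u) ∈ s.marked → G.Adj u x → (u, x) ∈ s.marked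

theorem initial_coherent (G : Digraph V) : (initial G).Coherent G := by
  intro u w x _ h
  exact absurd h (Set.notMem_empty _)

/-- The tails of the edges marked since the edges in `M` were marked are dominated by `D`. -/
structure Dominated (G : Digraph V) (M : Set (V × V)) (D : Finset V) (s : Config V) : Prop where
  coherent : s.Coherent G
  subset : M ⊆ s.marked
  red : ∀ u, (s.pebbles u).IsRed → u ∈ D ∨ (∀ x, G.Adj u x → (u, x) ∈ s.marked) ∨
    (¬ IsSource G u ∧ ∀ w, (w, u) ∉ M)
  tail : ∀ u v, (u, v) ∈ s.marked → (u, v) ∉ M → u ∈ D ∨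
    (¬ IsSource G u ∧ ∀ w, G.Adj w u → (w, u) ∈ s.marked ∧ (w, u) ∉ M)

theorem Dominated.mono {M : Set (V × V)} {D D' : Finset V} {s : Config V}
    (h : Dominated G M D s) (hD : D ⊆ D') : Dominated G M D' s where
  coherent := h.coherent
  subset := h.subset
  red u hu := (h.red u hu).imp_left (@hD u)
  tail u v h₁ h₂ := (h.tail u v h₁ h₂).imp_left (@hD u)

/-- Changing the pebbles of one node, without computing it. -/
theorem Dominated.update [DecidableEq V] {M : Set (V × V)} {D : Finset V} {s : Config V}
    (h : Dominated G M D s) (v : V) (p : Pebbles)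
    (hempty : p = .empty → ∀ x, G.Adj v x → (v, x) ∈ s.marked)
    (hred : p.IsRed → (s.pebbles v).IsRed ∨ v ∈ D) :
    Dominated G M D ⟨Function.update s.pebbles v p, s.marked⟩ where
  coherent := by
    intro u w x hu hw hx
    rcases eq_or_ne u v with rfl | huv
    · exact hempty (by simpa using hu) x hx
    · exact h.coherent u w x (by simpa [huv] using hu) hw hx
  subset := h.subset
  red := by
    intro u hu
    rcases eq_or_ne u v with rfl | huv
    · rcases hred (by simpa using hu) with h' | h'
      · exact h.red u h'
      · exact .inl h'
    · exact h.red u (by simpa [huv] using hu)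
  tail := h.tail

/-- Only a load can turn red a node for which no alternative of `red` is available, and it pays for
the new element of `D`. Every other operation keeps `D`. -/
theorem Dominated.step [DecidableEq V] {M : Set (V × V)} {D : Finset V} {s t : Config V} {o : Op V}
    (h : Dominated G M D s) (hst : Step G s o t) :
    ∃ D' : Finset V, D'.card ≤ D.card + o.cost ∧ Dominated G M D' t := by
  cases hst with
  | save v hv =>
    exact ⟨D, by simp [Op.cost], h.update v _ (by simp) fun _ => .inl (.inr hv)⟩
  | load v hv =>
    exact ⟨insert v D, Finset.card_insert_le _ _,
      (h.mono (Finset.subset_insert _ _)).update v _ (by simp) fun _ => .inr (by simp)⟩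
  | deleteLight v hv =>
    exact ⟨D, by simp [Op.cost], h.update v _ (by simp) (by simp [Pebbles.IsRed])⟩
  | deleteDark v hv hout =>
    exact ⟨D, by simp [Op.cost], h.update v _ (fun _ => hout) (by simp [Pebbles.IsRed])⟩
  | compute u v huv hnew hu hured hv =>
    refine ⟨D, by simp [Op.cost], ?_, ?_, ?_, ?_⟩
    · intro z w x hz hw hx
      rcases eq_or_ne z v with rfl | hzv
      · simp at hz
      · refine .inr (h.coherent z w x (by simpa [hzv] using hz) ?_ hx)
        rcases hw with hw | hw
        · exact absurd (congrArg Prod.snd hw) hzv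
        · exact hw
    · exact h.subset.trans (Set.subset_insert _ _)
    · intro z hz
      have lift : (z ∈ D ∨ (∀ x, G.Adj z x → (z, x) ∈ s.marked) ∨
          (¬ IsSource G z ∧ ∀ w, (w, z) ∉ M)) → (z ∈ D ∨
          (∀ x, G.Adj z x → (z, x) ∈ insert (u, v) s.marked) ∨
          (¬ IsSource G z ∧ ∀ w, (w, z) ∉ M)) :=
        Or.imp_right (Or.imp_left fun h' x hx => .inr (h' x hx))
      apply lift
      rcases eq_or_ne z v with rfl | hzv
      · rcases hv with hv | hv
        · exact h.red z hv
        -- An empty target with a marked incoming edge is already finished, by coherence. Otherwise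
        -- its computation starts only now, so none of its incoming edges lies in `M`.
        · by_cases hw : ∃ w, (w, z) ∈ s.marked
          · obtain ⟨w, hw⟩ := hw
            exact .inr (.inl fun x hx => h.coherent z w x hv hw hx)
          · push Not at hw
            exact .inr (.inr ⟨fun hs => hs u huv, fun w hwM => hw w (h.subset hwM)⟩)
      · exact h.red z (by simpa [hzv] using hz)
    · intro z x hzx hM
      rcases hzx with hzx | hzx
      · obtain ⟨rfl, rfl⟩ := Prod.mk.inj hzx
        rcases h.red z hured with h' | h' | h'
        · exact .inl h'
        · exact absurd (h' x huv) hnew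
        -- The rule for a compute requires the incoming edges of the tail to be marked; none of them
        -- lies in `M`, so all were marked in this phase.
        · exact .inr ⟨h'.1, fun w hw => ⟨.inr (hu w hw), h'.2 w⟩⟩
      · exact (h.tail z x hzx hM).imp_right fun h' =>
          ⟨h'.1, fun w hw => ⟨.inr (h'.2 w hw).1, (h'.2 w hw).2⟩⟩

theorem Dominated.run [DecidableEq V]
    {M : Set (V × V)} {D : Finset V} {s t : Config V} {ops : List (Op V)}
    (h : Dominated G M D s) (hst : Run G r s ops t) :
    ∃ D' : Finset V, D'.card ≤ D.card + cost ops ∧ Dominated G M D' t := by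
  induction hst generalizing D with
  | nil s hs => exact ⟨D, by simp, h⟩
  | cons s t u o ops hs hstep hrun ih =>
    obtain ⟨D₁, hD₁, h₁⟩ := h.step hstep
    obtain ⟨D₂, hD₂, h₂⟩ := ih h₁
    exact ⟨D₂, by rw [cost_cons]; omega, h₂⟩

theorem dominated_start {s : Config V} (hs : s.Coherent G) {D : Finset V}
    (hD : ∀ u, (s.pebbles u).IsRed → u ∈ D) : Dominated G s.marked D s where
  coherent := hs
  subset := subset_rfl
  red u hu := .inl (hD u hu)
  tail _ _ h₁ h₂ := absurd h₁ h₂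

/-- `U` is dominated by `D`: every node of `U` outside `D` is an inner node all of whose
predecessors are in `U`. -/
def IsDominatedBy (G : Digraph V) (U D : Finset V) : Prop :=
  ∀ u ∈ U, u ∉ D → ¬ IsSource G u ∧ ∀ w, G.Adj w u → w ∈ U

theorem Config.FitsIn.exists_finset {s : Config V} (hs : s.FitsIn r) :
    ∃ D : Finset V, D.card ≤ r ∧ ∀ u, (s.pebbles u).IsRed → u ∈ D := by
  have hfin : {v | (s.pebbles v).IsRed}.Finite :=
    Set.finite_of_encard_le_coe hs
  refine ⟨hfin.toFinset, ?_, fun u hu => by simpa using hu⟩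
  have := hs
  rw [Config.FitsIn, hfin.encard_eq_coe_toFinset_card] at this
  exact_mod_cast this

theorem Run.coherent [DecidableEq V] {s t : Config V} {ops : List (Op V)} (hst : Run G r s ops t)
    (hs : s.Coherent G) : t.Coherent G := by
  obtain ⟨D, -, hD⟩ := hst.fitsIn_left.exists_finset
  obtain ⟨_, -, h⟩ := (dominated_start hs hD).run hst
  exact h.coherent

/-- Take for `U` the tails of the newly marked edges: if all incoming edges of a node are newly
marked, its predecessors are such tails themselves. Leaving `D` free allows `D = ∅` for the run from
the initial configuration. -/
theorem Run.exists_isDominatedBy [DecidableEq V] [Fintype V] {s t : Config V} {ops : List (Op V)}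
    (hst : Run G r s ops t) (hs : s.Coherent G) {D : Finset V}
    (hD : ∀ u, (s.pebbles u).IsRed → u ∈ D) :
    ∃ U D' : Finset V, D'.card ≤ D.card + cost ops ∧ IsDominatedBy G U D' ∧
      ∀ u v, (u, v) ∈ t.marked → (u, v) ∉ s.marked → u ∈ U := by
  classical
  obtain ⟨D', hD', h⟩ := (dominated_start hs hD).run hst
  refine ⟨Finset.univ.filter fun u => ∃ v, (u, v) ∈ t.marked ∧ (u, v) ∉ s.marked,
    D', hD', ?_, ?_⟩
  · intro u hu huD
    simp only [Finset.mem_filter_univ] at hu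
    obtain ⟨v, h₁, h₂⟩ := hu
    obtain ⟨h₃, h₄⟩ := (h.tail u v h₁ h₂).resolve_left huD
    refine ⟨h₃, fun w hw => ?_⟩
    simp only [Finset.mem_filter_univ]
    exact ⟨u, h₄ w hw⟩
  · intro u v h₁ h₂
    simp only [Finset.mem_filter_univ]
    exact ⟨v, h₁, h₂⟩

/-- If sets dominated by at most `2 * r` nodes have at most `F` elements, then a run of cost at
most `(n + 1) * r` marks outgoing edges of at most `(n + 1) * F` nodes. -/
theorem Run.exists_tails [DecidableEq V] [Fintype V] {F : ℝ}
    (hF : ∀ U D : Finset V, IsDominatedBy G U D → D.card ≤ 2 * r → (U.card : ℝ) ≤ F)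
    (n : ℕ) {s t : Config V} {ops : List (Op V)} (hst : Run G r s ops t) (hs : s.Coherent G)
    (hcost : cost ops ≤ (n + 1) * r) :
    ∃ T : Finset V, (T.card : ℝ) ≤ (n + 1) * F ∧
      ∀ u v, (u, v) ∈ t.marked → (u, v) ∉ s.marked → u ∈ T := by
  induction n generalizing s ops with
  | zero =>
    obtain ⟨D, hDr, hD⟩ := hst.fitsIn_left.exists_finset
    obtain ⟨U, D', hD', hU, hUt⟩ := hst.exists_isDominatedBy hs hD
    exact ⟨U, by simpa using hF U D' hU (by omega), hUt⟩
  | succ n ih =>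
    obtain ⟨ops₁, ops₂, u, h₁, h₂, hc₁, hc₂⟩ := hst.split r
    obtain ⟨D, hDr, hD⟩ := h₁.fitsIn_left.exists_finset
    obtain ⟨U, D', hD', hU, hUt⟩ := h₁.exists_isDominatedBy hs hD
    have hUF := hF U D' hU (by omega)
    obtain ⟨T, hT, hTt⟩ := ih h₂ (h₁.coherent hs) (by
      have : (n + 1 + 1) * r = (n + 1) * r + r := by ring
      omega)
    refine ⟨U ∪ T, ?_, fun a b hab hs' => ?_⟩
    · have : ((U ∪ T).card : ℝ) ≤ U.card + T.card := by exact_mod_cast Finset.card_union_le _ _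
      push_cast
      linarith
    · by_cases hm : (a, b) ∈ u.marked
      · exact Finset.mem_union_left _ (hUt a b hm hs')
      · exact Finset.mem_union_right _ (hTt a b hab hm)

end Game

/-! ### A strategy with two red pebbles -/

section Existence

variable {V : Type*} {G : Digraph V} {r : ℕ}

open Classical in
/-- The configuration without red pebbles in which the edges in `M` are marked, and everything
computed so far is saved. -/
noncomputable def saved (G : Digraph V) (M : Set (V × V)) : Config V where
  pebbles v := if IsSource G v ∨ ∃ u, (u, v) ∈ M then .blue else .empty
  marked := M

theorem saved_empty (G : Digraph V) : saved G ∅ = initial G := by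
  classical
  simp only [saved, initial, Config.mk.injEq, and_true]
  funext v
  refine if_congr ⟨fun h => h.resolve_right fun ⟨u, hu⟩ => Set.notMem_empty _ hu, .inl⟩ rfl rfl

theorem fitsIn_two {s : Config V} (hr : 2 ≤ r) (u v : V)
    (h : ∀ w, w ≠ u → w ≠ v → ¬ (s.pebbles w).IsRed) : s.FitsIn r := by
  have hsub : {w | (s.pebbles w).IsRed} ⊆ {u, v} := by
    intro w hw
    by_contra hn
    simp only [Set.mem_insert_iff, Set.mem_singleton_iff, not_or] at hn
    exact h w hn.1 hn.2 hw
  calc _ ≤ ({u, v} : Set V).encard := Set.encard_le_encard hsub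
    _ ≤ 2 := by
      refine (Set.encard_insert_le _ _).trans ?_
      rw [Set.encard_singleton]
      norm_num
    _ ≤ r := by exact_mod_cast hr

/-- Load `u`, load `v` if it has been partially computed before, compute, save `v`, and delete both
light pebbles. Only `u` and `v` are ever red. -/
theorem saved_run [DecidableEq V]
    (hr : 2 ≤ r) {M : Set (V × V)} {u v : V} (huv : G.Adj u v) (hne : u ≠ v)
    (hnew : (u, v) ∉ M) (hu : ∀ w, G.Adj w u → (w, u) ∈ M) :
    ∃ ops, Run G r (saved G M) ops (saved G (insert (u, v) M)) := by
  classical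
  have hub : (saved G M).pebbles u = .blue := by
    simp only [saved]
    rw [if_pos]
    by_cases hs : IsSource G u
    · exact .inl hs
    · simp only [IsSource, not_forall, not_not] at hs
      obtain ⟨w, hw⟩ := hs
      exact .inr ⟨w, hu w hw⟩
  have hblue : ∀ w, ¬ ((saved G M).pebbles w).IsRed := by
    intro w
    simp only [saved, Pebbles.IsRed]
    split_ifs <;> simp
  set p := (saved G M).pebbles with hp
  -- All configurations of the run are written as two nested updates of `p`, so that this one bound
  -- covers them.
  have hfit : ∀ (q₁ q₂ : Pebbles) (M' : Set (V × V)),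
      (⟨Function.update (Function.update p u q₁) v q₂, M'⟩ : Config V).FitsIn r := by
    intro q₁ q₂ M'
    refine fitsIn_two hr u v fun w hwu hwv => ?_
    simpa [hwu, hwv] using hblue w
  have hfinal : saved G (insert (u, v) M) =
      ⟨Function.update (Function.update p u .blue) v .blue, insert (u, v) M⟩ := by
    simp only [saved, Config.mk.injEq, and_true]
    funext w
    rcases eq_or_ne w v with rfl | hwv
    · simp
    · rcases eq_or_ne w u with rfl | hwu
      · have h' := hub
        simp only [hp, saved] at h'
        simpa [hne] using h'
      · simp [hwv, hwu, hp, saved]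
  have hsM : saved G M = ⟨Function.update (Function.update p u .blue) v (p v), M⟩ := by
    rw [← hub]
    simp [hp, saved]
  have hvv : p v = .blue ∨ p v = .empty := by
    simp only [hp, saved]
    split_ifs <;> simp
  have hcomm : ∀ q₁ q₂ q₃ : Pebbles,
      Function.update (Function.update (Function.update p u q₁) v q₂) u q₃ =
        Function.update (Function.update p u q₃) v q₂ := by
    intro q₁ q₂ q₃
    rw [Function.update_comm hne, Function.update_idem, Function.update_comm hne.symm]
  have hload : Run G r (saved G M) [.load u]
      ⟨Function.update (Function.update p u .blueLight) v (p v), M⟩ := by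
    refine .cons _ _ _ _ _ (by rw [hsM]; exact hfit _ _ _) ?_ (.nil _ (hfit _ _ _))
    have := Step.load (G := G) (saved G M) u (.inl hub)
    rw [hsM] at this
    simpa [hcomm, hsM] using this
  have hrest : ∀ q : Pebbles, q.IsRed ∨ q = .empty →
      Run G r ⟨Function.update (Function.update p u .blueLight) v q, M⟩
        [.compute u v, .save v, .delete v, .delete u] (saved G (insert (u, v) M)) := by
    intro q hq
    have h1 := Step.compute (G := G)
      ⟨Function.update (Function.update p u .blueLight) v q, M⟩ u v huv hnew hu
      (by simp [hne, Pebbles.IsRed]) (by simpa using hq)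
    simp only [Function.update_idem] at h1
    refine .cons _ _ _ _ _ (hfit _ _ _) h1 ?_
    have h2 := Step.save (G := G) ⟨Function.update (Function.update p u .blueLight) v .dark,
      insert (u, v) M⟩ v (by simp)
    simp only [Function.update_idem] at h2
    refine .cons _ _ _ _ _ (hfit _ _ _) h2 ?_
    have h3 := Step.deleteLight (G := G)
      ⟨Function.update (Function.update p u .blueLight) v .blueLight, insert (u, v) M⟩ v (by simp)
    simp only [Function.update_idem] at h3
    refine .cons _ _ _ _ _ (hfit _ _ _) h3 ?_
    have h4 := Step.deleteLight (G := G)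
      ⟨Function.update (Function.update p u .blueLight) v .blue, insert (u, v) M⟩ u
      (by simp [hne])
    simp only [hcomm] at h4
    refine .cons _ _ _ _ _ (hfit _ _ _) h4 ?_
    rw [hfinal]
    exact .nil _ (hfit _ _ _)
  rcases hvv with hvb | hve
  · have hloadv : Run G r ⟨Function.update (Function.update p u .blueLight) v (p v), M⟩ [.load v]
        ⟨Function.update (Function.update p u .blueLight) v .blueLight, M⟩ := by
      refine .cons _ _ _ _ _ (hfit _ _ _) ?_ (.nil _ (hfit _ _ _))
      have := Step.load (G := G)
        ⟨Function.update (Function.update p u .blueLight) v (p v), M⟩ v (by simp [Pebbles.HasBlue, hvb])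
      simpa only [Function.update_idem] using this
    exact ⟨_, hload.append (hloadv.append (hrest _ (.inl (.inl rfl))))⟩
  · exact ⟨_, hload.append (hrest _ (.inr hve))⟩

/-- On a finite DAG, two red pebbles suffice. -/
theorem exists_isPebbling [DecidableEq V] [Finite V]
    (h : V → ℕ) (hG : ∀ u v, G.Adj u v → h u < h v)
    (hr : 2 ≤ r) : ∃ ops, IsPebbling G r ops := by
  classical
  let E : Set (V × V) := {e | G.Adj e.1 e.2}
  have key : ∀ n (M : Set (V × V)), M ⊆ E → (E \ M).ncard = n →
      ∃ ops, Run G r (saved G M) ops (saved G E) := by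
    intro n
    induction n with
    | zero =>
      intro M hM hn
      have : E \ M = ∅ := (Set.ncard_eq_zero (Set.toFinite _)).1 hn
      have hEM : M = E := hM.antisymm (Set.sdiff_eq_empty.1 this)
      subst hEM
      refine ⟨[], .nil _ ?_⟩
      rw [Config.FitsIn, Set.encard_eq_zero.2]
      · exact zero_le
      · ext w
        simp only [saved, Pebbles.IsRed, Set.mem_ofPred_eq, Set.mem_empty_iff_false, iff_false]
        split_ifs <;> simp
    | succ n ih =>
      intro M hM hn
      have hne : (E \ M).Nonempty := (Set.ncard_pos (Set.toFinite _)).1 (by omega)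
      -- Choose an unmarked edge whose tail has least height: an unmarked edge into `u` would have a
      -- lower tail.
      obtain ⟨⟨u, v⟩, ⟨huv, hnew⟩, hmin⟩ :=
        (Set.toFinite (E \ M)).exists_minimalFor (fun e => h e.1) _ hne
      have hu : ∀ w, G.Adj w u → (w, u) ∈ M := by
        intro w hw
        by_contra hwM
        have h₁ := hG w u hw
        have h₂ := hmin (j := (w, u)) ⟨hw, hwM⟩ h₁.le
        simp only at h₂
        omega
      obtain ⟨ops₁, h₁⟩ := saved_run hr huv
        (fun he => (hG u v huv).ne (congrArg h he)) hnew hu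
      obtain ⟨ops₂, h₂⟩ := ih (insert (u, v) M) (Set.insert_subset huv hM) (by
        have : E \ insert (u, v) M = (E \ M) \ {(u, v)} := by
          ext e
          simp only [Set.mem_sdiff, Set.mem_insert_iff, Set.mem_singleton_iff]
          tauto
        have hmem : (u, v) ∈ E \ M := ⟨huv, hnew⟩
        rw [this, Set.ncard_sdiff_singleton_of_mem hmem, hn]
        rfl)
      exact ⟨_, h₁.append h₂⟩
  obtain ⟨ops, hops⟩ := key _ ∅ (Set.empty_subset _) rfl
  rw [saved_empty] at hops
  refine ⟨ops, _, hops, fun v hv => .inl ?_, fun u v huv => huv⟩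
  simp only [saved]
  rw [if_pos]
  by_cases hs : IsSource G v
  · exact .inl hs
  · simp only [IsSource, not_forall, not_not] at hs
    obtain ⟨w, hw⟩ := hs
    exact .inr ⟨w, hw⟩

end Existence

end PRBP

namespace PRBP

/-! ### Counting dominated nodes in the butterfly -/

section Counting

/-- `s log₂ (2 s)`, up to the factor `log 2`. -/
noncomputable def entropyBound (s : ℝ) : ℝ := s * Real.log (2 * s)

/-- With `φ x = x log x`, this is `φ (2a) + φ b ≤ φ a + φ (a + b)`. It holds by convexity, since
`2a` and `b` lie between `a` and `a + b` and the two pairs have the same sum; the weights are `a /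
b` and `1 - a / b`. -/
theorem mul_log_add_le_of_le {a b : ℝ} (ha : 0 ≤ a) (hab : a ≤ b) :
    a * Real.log a + b * Real.log b + 2 * a * Real.log 2 ≤ (a + b) * Real.log (a + b) := by
  rcases ha.eq_or_lt with rfl | ha
  · simp
  have hb : 0 < b := ha.trans_le hab
  have hconv := Real.convexOn_mul_log
  have hq : a / b ≤ 1 := (div_le_one hb).2 hab
  have hmem : a ∈ Set.Ici (0 : ℝ) := ha.le
  have hmem' : a + b ∈ Set.Ici (0 : ℝ) := add_nonneg ha.le hb.le
  have hq₀ : 0 ≤ a / b := by positivity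
  have h₁ := hconv.2 hmem hmem' (sub_nonneg.2 hq) hq₀ (sub_add_cancel _ _)
  have h₂ := hconv.2 hmem hmem' hq₀ (sub_nonneg.2 hq) (add_sub_cancel _ _)
  simp only [smul_eq_mul] at h₁ h₂
  have e₁ : (1 - a / b) * a + a / b * (a + b) = 2 * a := by field_simp; ring
  have e₂ : a / b * a + (1 - a / b) * (a + b) = b := by field_simp; ring
  rw [e₁, Real.log_mul two_ne_zero ha.ne'] at h₁
  rw [e₂] at h₂
  linarith

theorem mul_log_add_le {a b d : ℝ} (ha : 0 ≤ a) (hb : 0 ≤ b) (hda : d ≤ a) (hdb : d ≤ b) :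
    a * Real.log a + b * Real.log b + 2 * d * Real.log 2 ≤ (a + b) * Real.log (a + b) := by
  have h2 : 0 < Real.log 2 := Real.log_pos one_lt_two
  rcases le_total a b with hab | hab
  · have := mul_log_add_le_of_le ha hab
    nlinarith
  · have := mul_log_add_le_of_le hb hab
    rw [add_comm b a] at this
    nlinarith

theorem entropyBound_eq {s : ℝ} : entropyBound s = s * Real.log s + s * Real.log 2 := by
  rcases eq_or_ne s 0 with rfl | hs
  · simp [entropyBound]
  · rw [entropyBound, Real.log_mul two_ne_zero hs]
    ring

theorem entropyBound_add {a b d : ℝ} (ha : 0 ≤ a) (hb : 0 ≤ b) (hda : d ≤ a) (hdb : d ≤ b) :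
    entropyBound a + entropyBound b + 2 * d * Real.log 2 ≤ entropyBound (a + b) := by
  have := mul_log_add_le ha hb hda hdb
  simp only [entropyBound_eq]
  linarith

/-- Pays for the `c` nodes of `D` in a new layer. Integrality matters: `x log (2 x)` is negative on
`(0, 1/2)`. -/
theorem entropyBound_add_nat (s c : ℕ) :
    entropyBound s + c * Real.log 2 ≤ entropyBound (s + c) := by
  have h2 : 0 < Real.log 2 := Real.log_pos one_lt_two
  rcases Nat.eq_zero_or_pos s with rfl | hs
  · rcases Nat.eq_zero_or_pos c with rfl | hc
    · simp
    · have hc' : (1 : ℝ) ≤ c := by exact_mod_cast hc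
      have : 0 ≤ Real.log c := Real.log_nonneg hc'
      simp only [entropyBound_eq, Nat.cast_zero, zero_add, zero_mul]
      nlinarith
  · have hs' : (1 : ℝ) ≤ s := by exact_mod_cast hs
    have hc' : (0 : ℝ) ≤ c := by positivity
    have h₁ : Real.log s ≤ Real.log (s + c) := Real.log_le_log (by linarith) (by linarith)
    have h₂ : 0 ≤ Real.log ((s : ℝ) + c) := Real.log_nonneg (by linarith)
    simp only [entropyBound_eq]
    nlinarith

theorem entropyBound_mono {a b : ℕ} (h : a ≤ b) : entropyBound a ≤ entropyBound b := by
  obtain ⟨c, rfl⟩ := Nat.exists_eq_add_of_le h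
  have := entropyBound_add_nat a c
  have h2 : 0 < Real.log 2 := Real.log_pos one_lt_two
  have : (0 : ℝ) ≤ c * Real.log 2 := by positivity
  push_cast
  linarith

/-- The elements of `S` in the layers `0, …, l` of the butterfly, in the block `b` of length
`2 ^ l`. -/
def belowBlock (S : Finset (ℕ × ℕ)) (l b : ℕ) : Finset (ℕ × ℕ) :=
  S.filter fun x => x.1 ≤ l ∧ x.2 / 2 ^ l = b

/-- The elements of `S` in the layer `l` of the butterfly, in the block `b` of length `2 ^ e`. -/
def layerBlock (S : Finset (ℕ × ℕ)) (l e b : ℕ) : Finset (ℕ × ℕ) :=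
  S.filter fun x => x.1 = l ∧ x.2 / 2 ^ e = b

theorem div_two_pow_succ (x l b : ℕ) :
    x / 2 ^ (l + 1) = b ↔ x / 2 ^ l = 2 * b ∨ x / 2 ^ l = 2 * b + 1 := by
  rw [pow_succ, ← Nat.div_div_eq_div_mul]
  omega

theorem card_belowBlock_succ (S : Finset (ℕ × ℕ)) (l b : ℕ) :
    (belowBlock S (l + 1) b).card = (belowBlock S l (2 * b)).card +
      (belowBlock S l (2 * b + 1)).card + (layerBlock S (l + 1) (l + 1) b).card := by
  rw [← Finset.card_union_of_disjoint, ← Finset.card_union_of_disjoint]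
  · congr 1
    ext x
    simp only [belowBlock, layerBlock, Finset.mem_filter, Finset.mem_union, div_two_pow_succ]
    have : x.1 ≤ l + 1 ↔ x.1 ≤ l ∨ x.1 = l + 1 := by omega
    tauto
  · rw [Finset.disjoint_left]
    intro x hx hx'
    simp only [belowBlock, layerBlock, Finset.mem_filter, Finset.mem_union] at hx hx'
    omega
  · rw [Finset.disjoint_left]
    intro x hx hx'
    simp only [belowBlock, Finset.mem_filter] at hx hx'
    omega

variable {U D : Finset (ℕ × ℕ)}

/-- A node of `U \ D` in the new layer has its predecessors, in both sub-blocks, in `U`. Keeping the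
residue modulo `2 ^ l` maps each half of the new layer injectively into the chosen sub-block, whence
the factor 2. As `e'` is arbitrary, the smaller sub-block may be used. -/
theorem card_layerBlock_succ_le
    (hU : ∀ l b i, i < 2 ^ l → ∀ e, e = 0 ∨ e = 1 →
      (l + 1, 2 ^ l * (2 * b + e) + i) ∈ U → (l + 1, 2 ^ l * (2 * b + e) + i) ∉ D →
      ∀ e', e' = 0 ∨ e' = 1 → (l, 2 ^ l * (2 * b + e') + i) ∈ U)
    (l b e' : ℕ) (he' : e' = 0 ∨ e' = 1) :
    (layerBlock U (l + 1) (l + 1) b).card ≤ (layerBlock D (l + 1) (l + 1) b).card +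
      2 * (layerBlock U l l (2 * b + e')).card := by
  have hpos : 0 < 2 ^ l := by positivity
  have half : ∀ e, e = 0 ∨ e = 1 →
      (layerBlock (U \ D) (l + 1) l (2 * b + e)).card ≤ (layerBlock U l l (2 * b + e')).card := by
    intro e he
    refine Finset.card_le_card_of_injOn (fun x => (l, 2 ^ l * (2 * b + e') + x.2 % 2 ^ l)) ?_ ?_
    · rintro ⟨x, y⟩ hx
      simp only [layerBlock, Finset.coe_filter, Finset.mem_sdiff, Set.mem_ofPred_eq] at hx ⊢
      obtain ⟨⟨hxU, hxD⟩, rfl, hy⟩ := hx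
      have hy' : y = 2 ^ l * (2 * b + e) + y % 2 ^ l := by
        rw [← hy, Nat.div_add_mod]
      have hlt := Nat.mod_lt y hpos
      refine ⟨hU l b (y % 2 ^ l) hlt e he (hy' ▸ hxU) (hy' ▸ hxD) e' he', trivial, ?_⟩
      rw [Nat.mul_add_div hpos, Nat.div_eq_of_lt hlt, add_zero]
    · rintro ⟨x, y⟩ hx ⟨x', y'⟩ hx' h
      simp only [layerBlock, Finset.coe_filter, Set.mem_ofPred_eq] at hx hx'
      simp only [Prod.mk.injEq, true_and, Nat.add_left_cancel_iff] at h
      have h₁ := Nat.div_add_mod y (2 ^ l)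
      have h₂ := Nat.div_add_mod y' (2 ^ l)
      rw [hx.2.2, h] at h₁
      rw [hx'.2.2] at h₂
      refine Prod.ext (hx.2.1.trans hx'.2.1.symm) (h₁.symm.trans h₂)
  have hsub : layerBlock U (l + 1) (l + 1) b ⊆ layerBlock D (l + 1) (l + 1) b ∪
      (layerBlock (U \ D) (l + 1) l (2 * b + 0) ∪ layerBlock (U \ D) (l + 1) l (2 * b + 1)) := by
    intro x
    simp only [layerBlock, Finset.mem_filter, Finset.mem_union, Finset.mem_sdiff,
      div_two_pow_succ, add_zero]
    tauto
  have h₀ := half 0 (.inl rfl)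
  have h₁ := half 1 (.inr rfl)
  have h₂ := Finset.card_le_card hsub
  have h₃ := Finset.card_union_le (layerBlock D (l + 1) (l + 1) b)
    (layerBlock (U \ D) (l + 1) l (2 * b + 0) ∪ layerBlock (U \ D) (l + 1) l (2 * b + 1))
  have h₄ := Finset.card_union_le (layerBlock (U \ D) (l + 1) l (2 * b + 0))
    (layerBlock (U \ D) (l + 1) l (2 * b + 1))
  omega

/-- In the butterfly, a set of `s` nodes dominates at most `s log₂ (2 s)` nodes, and at most `s`
nodes of the last layer. -/
theorem card_belowBlock_le
    (hU₀ : ∀ i, (0, i) ∈ U → (0, i) ∈ D)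
    (hU : ∀ l b i, i < 2 ^ l → ∀ e, e = 0 ∨ e = 1 →
      (l + 1, 2 ^ l * (2 * b + e) + i) ∈ U → (l + 1, 2 ^ l * (2 * b + e) + i) ∉ D →
      ∀ e', e' = 0 ∨ e' = 1 → (l, 2 ^ l * (2 * b + e') + i) ∈ U)
    (l b : ℕ) :
    (layerBlock U l l b).card ≤ (belowBlock D l b).card ∧
      (belowBlock U l b).card * Real.log 2 ≤ entropyBound (belowBlock D l b).card := by
  have h2 : 0 < Real.log 2 := Real.log_pos one_lt_two
  induction l generalizing b with
  | zero =>
    have hsub : belowBlock U 0 b ⊆ belowBlock D 0 b := by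
      rintro ⟨x, y⟩
      simp only [belowBlock, Finset.mem_filter, nonpos_iff_eq_zero]
      rintro ⟨hx, rfl, hy⟩
      exact ⟨hU₀ _ hx, rfl, hy⟩
    have hcard := Finset.card_le_card hsub
    refine ⟨?_, ?_⟩
    · simpa [belowBlock, layerBlock] using hcard
    · have := entropyBound_add_nat 0 (belowBlock D 0 b).card
      have h0 : entropyBound ((0 : ℕ) : ℝ) = 0 := by simp [entropyBound]
      rw [h0] at this
      simp only [Nat.cast_zero, zero_add] at this
      refine le_trans ?_ this
      gcongr
  | succ l ih =>
    obtain ⟨hA, hA'⟩ := ih (2 * b)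
    obtain ⟨hB, hB'⟩ := ih (2 * b + 1)
    have h₀ := card_layerBlock_succ_le hU l b 0 (.inl rfl)
    have h₁ := card_layerBlock_succ_le hU l b 1 (.inr rfl)
    rw [add_zero] at h₀
    rw [card_belowBlock_succ, card_belowBlock_succ]
    refine ⟨by omega, ?_⟩
    have hadd := entropyBound_add_nat
      ((belowBlock D l (2 * b)).card + (belowBlock D l (2 * b + 1)).card)
      (layerBlock D (l + 1) (l + 1) b).card
    -- The last-layer bound for both sub-blocks makes `d` at most both dominator counts. The gain `2
    -- d log 2` from merging the sub-blocks then pays for the new nodes outside `D`.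
    have hmin : ∃ d : ℕ, d ≤ (belowBlock D l (2 * b)).card ∧
        d ≤ (belowBlock D l (2 * b + 1)).card ∧
        (layerBlock U (l + 1) (l + 1) b).card ≤ (layerBlock D (l + 1) (l + 1) b).card + 2 * d :=
      ⟨min (layerBlock U l l (2 * b)).card (layerBlock U l l (2 * b + 1)).card,
        by omega, by omega, by omega⟩
    obtain ⟨d, hda, hdb, hd⟩ := hmin
    have hsum := entropyBound_add (a := (belowBlock D l (2 * b)).card)
      (b := (belowBlock D l (2 * b + 1)).card) (d := d) (by positivity) (by positivity)
      (by exact_mod_cast hda) (by exact_mod_cast hdb)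
    have hd' : ((layerBlock U (l + 1) (l + 1) b).card : ℝ) * Real.log 2 ≤
        ((layerBlock D (l + 1) (l + 1) b).card + 2 * d) * Real.log 2 := by
      gcongr
      exact_mod_cast hd
    push_cast at hadd ⊢
    linarith

end Counting

/-! ### Application to the butterfly graph -/

section FFT

theorem fft_adj_iff {k l l' b i e e' : ℕ} (hi : i < 2 ^ l) (he : e = 0 ∨ e = 1)
    (he' : e' = 0 ∨ e' = 1) (hl : l < k + 1) (hl' : l' < k + 1)
    (h : 2 ^ l * (2 * b + e) + i < 2 ^ k) (h' : 2 ^ l * (2 * b + e') + i < 2 ^ k) :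
    (fft k).Adj (⟨l, hl⟩, ⟨_, h⟩) (⟨l', hl'⟩, ⟨_, h'⟩) ↔ l' = l + 1 := by
  have hdiv : ∀ e, e = 0 ∨ e = 1 → (2 ^ l * (2 * b + e) + i) / 2 ^ (l + 1) = b := by
    intro e he
    rw [div_two_pow_succ, Nat.mul_add_div (by positivity), Nat.div_eq_of_lt hi]
    omega
  simp only [fft, Nat.ModEq, hdiv e he, hdiv e' he', Nat.mul_add_mod, and_self, and_true]

theorem isSource_fft {k : ℕ} (x : Fin (k + 1) × Fin (2 ^ k)) (hx : (x.1 : ℕ) = 0) :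
    IsSource (fft k) x := by
  intro u hu
  have := hu.1
  omega

theorem fft_adj_same {k l : ℕ} (hl : l < k) (i : Fin (2 ^ k)) :
    (fft k).Adj (⟨l, by omega⟩, i) (⟨l + 1, by omega⟩, i) :=
  ⟨rfl, rfl, rfl⟩

/-- The graph is embedded into `ℕ × ℕ`, where it is the single block `0` of level `k`. -/
theorem card_mul_log_two_le_of_isDominatedBy {k : ℕ} {U D : Finset (Fin (k + 1) × Fin (2 ^ k))}
    (h : IsDominatedBy (fft k) U D) : U.card * Real.log 2 ≤ entropyBound D.card := by
  classical
  let f : Fin (k + 1) × Fin (2 ^ k) ↪ ℕ × ℕ :=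
    ⟨fun x => (x.1, x.2), fun x y hxy => by
      simp only [Prod.mk.injEq] at hxy
      exact Prod.ext (Fin.ext hxy.1) (Fin.ext hxy.2)⟩
  have hmem : ∀ (S : Finset (Fin (k + 1) × Fin (2 ^ k))) (l i : ℕ), (l, i) ∈ S.map f ↔
      ∃ (hl : l < k + 1) (hi : i < 2 ^ k), (⟨l, hl⟩, ⟨i, hi⟩) ∈ S := by
    intro S l i
    simp only [Finset.mem_map]
    constructor
    · rintro ⟨⟨a, b⟩, hab, he⟩
      obtain ⟨rfl, rfl⟩ := Prod.mk.inj he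
      exact ⟨a.2, b.2, hab⟩
    · rintro ⟨hl, hi, hS⟩
      exact ⟨_, hS, rfl⟩
  have hblock : ∀ S : Finset (Fin (k + 1) × Fin (2 ^ k)), belowBlock (S.map f) k 0 = S.map f := by
    intro S
    refine Finset.filter_true_of_mem ?_
    rintro ⟨l, i⟩ hS
    obtain ⟨hl, hi, -⟩ := (hmem S l i).1 hS
    exact ⟨by simpa using Nat.lt_succ_iff.1 hl, Nat.div_eq_of_lt hi⟩
  have key := (card_belowBlock_le (U := U.map f) (D := D.map f) ?_ ?_ k 0).2
  · simpa only [hblock, Finset.card_map] using key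
  · intro i hi
    obtain ⟨hl, hi, hU⟩ := (hmem U _ _).1 hi
    by_contra hD
    refine (h _ hU fun hD' => hD ((hmem D _ _).2 ⟨hl, hi, hD'⟩)).1 (isSource_fft _ rfl)
  · intro l b i hi e he hU hD e' he'
    obtain ⟨hl, hlt, hU⟩ := (hmem U _ _).1 hU
    have hpred := (h _ hU fun hD' => hD ((hmem D _ _).2 ⟨hl, hlt, hD'⟩)).2
    have hlt' : 2 ^ l * (2 * b + e') + i < 2 ^ k := by
      -- The whole block of length `2 ^ (l + 1)` lies below `2 ^ k`, so the index in the other half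
      -- is in range too.
      have hbk : b < 2 ^ (k - (l + 1)) := by
        by_contra hcon
        have h₁ : 2 ^ (l + 1) * 2 ^ (k - (l + 1)) = 2 ^ k := by
          rw [← pow_add, Nat.add_sub_cancel' (by omega)]
        have h₂ := Nat.mul_le_mul_left (2 ^ (l + 1)) (not_lt.1 hcon)
        have h₃ : 2 ^ l * (2 * b + e) = 2 ^ (l + 1) * b + 2 ^ l * e := by ring
        omega
      have h₁ : 2 ^ (l + 1) * 2 ^ (k - (l + 1)) = 2 ^ k := by
        rw [← pow_add, Nat.add_sub_cancel' (by omega)]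
      have h₂ := Nat.mul_le_mul_left (2 ^ (l + 1)) (Nat.succ_le_of_lt hbk)
      have h₃ : 2 ^ l * (2 * b + e') + i < 2 ^ (l + 1) * (b + 1) := by
        rcases he' with rfl | rfl <;> ring_nf <;> omega
      exact lt_of_lt_of_le h₃ (h₂.trans_eq h₁)
    exact (hmem U _ _).2 ⟨by omega, hlt',
      hpred _ ((fft_adj_iff hi he' he _ _ hlt' hlt).2 rfl)⟩

/-- The butterfly has at least `k * 2 ^ k` nodes that are not sinks. -/
theorem mul_two_pow_le_card {k : ℕ} {T : Finset (Fin (k + 1) × Fin (2 ^ k))}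
    (hT : ∀ u v, (fft k).Adj u v → u ∈ T) : k * 2 ^ k ≤ T.card := by
  have := Finset.card_le_card_of_injOn
    (s := (Finset.univ : Finset (Fin k × Fin (2 ^ k)))) (t := T)
    (fun x => (x.1.castSucc, x.2)) (fun x _ => hT _ _ (fft_adj_same x.1.2 x.2)) (by
      rintro ⟨a, b⟩ _ ⟨c, d⟩ _ h
      simpa using h)
  simpa using this

theorem cost_lower_bound {k r : ℕ} (hr : 2 ≤ r) {ops : List (Op (Fin (k + 1) × Fin (2 ^ k)))}
    (h : IsPebbling (fft k) r ops) :
    1 / 12 * (((2 ^ k : ℕ) : ℝ) * Real.log ((2 ^ k : ℕ) : ℝ) / Real.log r) ≤ cost ops := by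
  obtain ⟨t, hrun, -, hmarked⟩ := h
  have h2 : 0 < Real.log 2 := Real.log_pos one_lt_two
  have hr2 : (2 : ℝ) ≤ r := by exact_mod_cast hr
  have hlr : Real.log 2 ≤ Real.log r := Real.log_le_log two_pos hr2
  have hlr0 : 0 < Real.log r := h2.trans_le hlr
  have hcoh := initial_coherent (fft k)
  have hunmarked : ∀ e, e ∉ (initial (fft k)).marked := fun e => Set.notMem_empty e
  suffices hmain : ((2 ^ k : ℕ) : ℝ) * Real.log ((2 ^ k : ℕ) : ℝ) ≤
      12 * (cost ops * Real.log r) by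
    rw [← mul_div_assoc, div_le_iff₀ hlr0]
    linarith
  -- Below cost `r`, rounding up the number of phases loses too much. There the whole run is one
  -- phase without initial red pebbles, so all sources lie in `D`; hence `2 ^ k ≤ cost ops < r` and
  -- `log m ≤ log r`.
  rcases lt_or_ge (cost ops) r with hC | hC
  · rcases Nat.eq_zero_or_pos k with rfl | hk
    · simp only [pow_zero, Nat.cast_one, Real.log_one, mul_zero]
      positivity
    have hm : 2 ^ k ≤ cost ops := by
      obtain ⟨U, D, hD, hU, hUt⟩ := hrun.exists_isDominatedBy hcoh (D := ∅) (by
        intro u hu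
        simp only [initial, Pebbles.IsRed] at hu
        split_ifs at hu <;> simp at hu)
      have hsub := Finset.card_le_card_of_injOn (s := (Finset.univ : Finset (Fin (2 ^ k))))
        (t := D) (fun i => (⟨0, by omega⟩, i)) (fun i _ => by
          by_contra hi
          exact (hU _ (hUt _ _ (hmarked _ _ (fft_adj_same hk i)) (hunmarked _)) hi).1
            (isSource_fft _ rfl)) (by
          intro a _ b _ hab
          simpa using hab)
      simp only [Finset.card_univ, Fintype.card_fin, Finset.card_empty] at hsub hD
      omega
    have hm' : ((2 ^ k : ℕ) : ℝ) ≤ cost ops := by exact_mod_cast hm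
    have hmr : ((2 ^ k : ℕ) : ℝ) ≤ r := by exact_mod_cast hm.trans hC.le
    have hpos : (0 : ℝ) < ((2 ^ k : ℕ) : ℝ) := by positivity
    have hlog := Real.log_le_log hpos hmr
    calc ((2 ^ k : ℕ) : ℝ) * Real.log ((2 ^ k : ℕ) : ℝ)
        ≤ ((2 ^ k : ℕ) : ℝ) * Real.log r := by gcongr
      _ ≤ cost ops * Real.log r := by gcongr
      _ ≤ 12 * (cost ops * Real.log r) := by
        have : 0 ≤ cost ops * Real.log r := by positivity
        linarith
  · have hrpos : 0 < r := by omega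
    obtain ⟨T, hT, hTt⟩ := hrun.exists_tails (F := entropyBound ((2 * r : ℕ) : ℝ) / Real.log 2)
      (fun U D hU hD => by
        rw [le_div_iff₀ h2]
        exact (card_mul_log_two_le_of_isDominatedBy hU).trans (entropyBound_mono hD))
      (cost ops / r) hcoh (by
        rw [mul_comm]
        exact (Nat.lt_mul_div_succ _ hrpos).le)
    have hTcard : ((k * 2 ^ k : ℕ) : ℝ) ≤ T.card := by
      exact_mod_cast mul_two_pow_le_card fun u v huv => hTt u v (hmarked u v huv) (hunmarked _)
    -- `log (4 r) = 2 log 2 + log r ≤ 3 log r`, because `r ≥ 2`. Together with the factor 2 from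
    -- rounding in `hphases` this gives the constant 12.
    have hent : entropyBound ((2 * r : ℕ) : ℝ) ≤ 6 * r * Real.log r := by
      have h4 : (2 : ℝ) * ((2 * r : ℕ) : ℝ) = 2 * (2 * r) := by push_cast; ring
      rw [entropyBound, h4, Real.log_mul two_ne_zero (by positivity),
        Real.log_mul two_ne_zero (by positivity)]
      push_cast
      nlinarith
    have hphases : (((cost ops / r : ℕ) : ℝ) + 1) * r ≤ 2 * cost ops := by
      have h₁ : (cost ops / r + 1) * r ≤ 2 * cost ops := by
        have := Nat.div_mul_le_self (cost ops) r
        rw [add_mul]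
        omega
      exact_mod_cast h₁
    have hlogm : Real.log ((2 ^ k : ℕ) : ℝ) = k * Real.log 2 := by
      push_cast
      rw [Real.log_pow]
    calc ((2 ^ k : ℕ) : ℝ) * Real.log ((2 ^ k : ℕ) : ℝ)
        = ((k * 2 ^ k : ℕ) : ℝ) * Real.log 2 := by rw [hlogm]; push_cast; ring
      _ ≤ (((cost ops / r : ℕ) : ℝ) + 1) * (entropyBound ((2 * r : ℕ) : ℝ) / Real.log 2) *
          Real.log 2 := by
        gcongr
        exact hTcard.trans hT
      _ = (((cost ops / r : ℕ) : ℝ) + 1) * entropyBound ((2 * r : ℕ) : ℝ) := by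
        field_simp
      _ ≤ (((cost ops / r : ℕ) : ℝ) + 1) * (6 * r * Real.log r) := by gcongr
      _ = 6 * Real.log r * ((((cost ops / r : ℕ) : ℝ) + 1) * r) := by ring
      _ ≤ 6 * Real.log r * (2 * cost ops) := by gcongr
      _ = 12 * (cost ops * Real.log r) := by ring

end FFT

end PRBP

theorem mainTheorem7 :
    ∃ c : ℝ, 0 < c ∧ ∀ k m r : ℕ, m = 2 ^ k → 2 ≤ r →
      ∃ C : ℕ, PRBP.opt (PRBP.fft k) r = (C : ℕ∞) ∧
        c * ((m : ℝ) * Real.log (m : ℝ) / Real.log (r : ℝ)) ≤ (C : ℝ) := by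
  refine ⟨1 / 12, by norm_num, ?_⟩
  rintro k m r rfl hr
  obtain ⟨ops, hops⟩ := PRBP.exists_isPebbling (G := PRBP.fft k) (r := r) (fun x => x.1)
    (fun u v huv => by have := huv.1; omega) hr
  have hle : PRBP.opt (PRBP.fft k) r ≤ (PRBP.cost ops : ℕ∞) := iInf₂_le ops hops
  obtain ⟨C, hC⟩ := ENat.ne_top_iff_exists.1 (ne_top_of_le_ne_top (ENat.natCast_ne_top _) hle)
  -- Passing to the ceiling turns the real bound into one in `ℕ∞`, where it can be compared with the
  -- infimum.
  refine ⟨C, hC.symm, Nat.ceil_le.1 ?_⟩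
  have hbound : ((⌈1 / 12 * (((2 ^ k : ℕ) : ℝ) * Real.log ((2 ^ k : ℕ) : ℝ) / Real.log r)⌉₊ : ℕ) :
      ℕ∞) ≤ PRBP.opt (PRBP.fft k) r :=
    le_iInf₂ fun ops hops => by exact_mod_cast Nat.ceil_le.2 (PRBP.cost_lower_bound hr hops)
  rw [← hC] at hbound
  exact_mod_cast hbound
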